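/- Let $A=\begin{pmatrix} a & b\\ c & d\end{pmatrix}\in\mathbb{R}^{2\times 2}$ be a zero-sum matrix game (the row player maximizes and the column player minimizes $\langle x,Ay\rangle$ over mixed strategies $x,y\in\triangle_2$, where $\triangle_2$ is the probability simplex) that has a unique Nash equilibrium, and suppose that this equilibrium is not a pair of pure strategies. Put $D=a-b-c+d$ and $\Delta_{\min}=\min\{|a-b|,|a-c|,|d-b|,|d-c|\}$, and suppose that $D>0$, $\Delta_{\min}=a-b$ and $a-c\ge d-b$. A (possibly randomized) algorithm plays, in each round, a pair $(i,j)$ that depends on its internal randomness and on the past observations, and observes a fresh independent outcome with distribution $\mathcal N(A_{ij},1)$; after a number $\tau$ of rounds, where $\tau$ is a stopping time with respect to its internal randomness and its observations, it halts and outputs a pair $(x,y)\in\triangle_2\times\triangle_2$. For a matrix $B\in\mathbb{R}^{2\times2}$ let $\mathbb P_B,\mathbb E_B$ denote the law and the expectation when the game is $B$, and let $V_B^*=\max_{x\in\triangle_2}\min_{y\in\triangle_2}\langle x,By\rangle$. The algorithm is $(\varepsilon,\delta)$-PAC-good if for every matrix $B\in\mathbb{R}^{2\times 2}$ it satisfies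 $\mathbb P_B(\tau<\infty)=1$ and $\mathbb P_B(|V_B^*-\langle x,By\rangle|\le\varepsilon)\ge 1-\delta$. Then for all $\varepsilon>0$ and $\delta\in(0,1)$, every $(\varepsilon,\delta)$-PAC-good algorithm satisfies $$\mathbb{E}_A[\tau]\ \ge\ \min\left\{\frac{\log(1/(30\delta))}{36\varepsilon^2},\ \frac{\log(1/(30\delta))}{36\Delta_{\min}^2}\right\}$$ and also $$\mathbb{E}_A[\tau]\ \ge\ \min\left\{\frac1{\varepsilon^2},\ \max\left\{\frac{1}{3\varepsilon|D|},\ \frac{1}{\Delta_{\min}^2}\right\}\right\}\cdot\frac{\log(1/(30\delta))}{36}.$$ -/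

import Mathlib

open MeasureTheory ProbabilityTheory
open scoped Matrix ENNReal

noncomputable section

namespace MatrixGame

/-- Expected payoff `⟨x, A y⟩` of the row player when the mixed strategies `x`, `y` are played. -/
def payoff {m n : ℕ} (A : Matrix (Fin m) (Fin n) ℝ) (x : Fin m → ℝ) (y : Fin n → ℝ) : ℝ :=
  x ⬝ᵥ (A *ᵥ y)

/-- The value `max_x min_y ⟨x, A y⟩` of the zero-sum game `A`. -/
def value {m n : ℕ} (A : Matrix (Fin m) (Fin n) ℝ) : ℝ :=
  ⨆ x : stdSimplex ℝ (Fin m), ⨅ y : stdSimplex ℝ (Fin n), payoff A x y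

/-- `(x, y)` is a Nash equilibrium: the row player maximizes, the column player minimizes. -/
def IsNash {m n : ℕ} (A : Matrix (Fin m) (Fin n) ℝ) (x : Fin m → ℝ) (y : Fin n → ℝ) : Prop :=
  x ∈ stdSimplex ℝ (Fin m) ∧ y ∈ stdSimplex ℝ (Fin n) ∧
    (∀ x' ∈ stdSimplex ℝ (Fin m), payoff A x' y ≤ payoff A x y) ∧
    (∀ y' ∈ stdSimplex ℝ (Fin n), payoff A x y ≤ payoff A x y')

/-- A pair of mixed strategies is pure if both supports are singletons. -/
def IsPure {m n : ℕ} (x : Fin m → ℝ) (y : Fin n → ℝ) : Prop :=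
  ∃ i j, Function.support x = {i} ∧ Function.support y = {j}

/-- The game has exactly one Nash equilibrium, and this equilibrium is not pure. -/
def HasUniqueMixedNash {m n : ℕ} (A : Matrix (Fin m) (Fin n) ℝ) : Prop :=
  ∃ x y, IsNash A x y ∧ ¬ IsPure x y ∧ ∀ x' y', IsNash A x' y' → x' = x ∧ y' = y

/-- `D = a - b - c + d` for the matrix `[a, b; c, d]`. -/
def gapD (A : Matrix (Fin 2) (Fin 2) ℝ) : ℝ :=
  A 0 0 - A 0 1 - A 1 0 + A 1 1

/-- `Δ_min = min {|a - b|, |a - c|, |d - b|, |d - c|}` for the matrix `[a, b; c, d]`. -/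
def gapMin (A : Matrix (Fin 2) (Fin 2) ℝ) : ℝ :=
  min (min |A 0 0 - A 0 1| |A 0 0 - A 1 0|) (min |A 1 1 - A 0 1| |A 1 1 - A 1 0|)

/-- A sequential, possibly randomized, sampling algorithm for `m × n` games. Its internal
randomness is a seed in `Ω` drawn from `seedLaw`. Given the seed and the `t` outcomes observed in
the first `t` rounds (the pairs played so far are functions of these), `halt t` says whether the
algorithm halts after `t` rounds, `output t` is the pair of mixed strategies which it returns if it
does, and `play t` is the pair of actions which is played in the next round if it does not. -/
structure Algorithm (m n : ℕ) (Ω : Type*) [MeasurableSpace Ω] where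
  seedLaw : Measure Ω
  isProbabilityMeasure_seedLaw : IsProbabilityMeasure seedLaw
  play : (t : ℕ) → Ω × (Fin t → ℝ) → Fin m × Fin n
  measurable_play : ∀ t, Measurable (play t)
  halt : (t : ℕ) → Set (Ω × (Fin t → ℝ))
  measurableSet_halt : ∀ t, MeasurableSet (halt t)
  output : (t : ℕ) → Ω × (Fin t → ℝ) → (Fin m → ℝ) × (Fin n → ℝ)
  measurable_output : ∀ t, Measurable (output t)
  output_mem : ∀ t h, (output t h).1 ∈ stdSimplex ℝ (Fin m) ∧
    (output t h).2 ∈ stdSimplex ℝ (Fin n)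

namespace Algorithm

variable {m n : ℕ} {Ω : Type*} [MeasurableSpace Ω]

/-- The sample space: a seed, and for each round `t` and each pair `(i, j)` the outcome `X_{ij}`
that is observed if the pair `(i, j)` is played in round `t`. -/
abbrev Sample (m n : ℕ) (Ω : Type*) : Type _ :=
  Ω × (ℕ → Fin m × Fin n → ℝ)

/-- The law of the seed and of the outcomes in the game `A`: all of them are independent, and the
outcomes of the pair `(i, j)` have the distribution `N(A i j, 1)`. -/
def law (alg : Algorithm m n Ω) (A : Matrix (Fin m) (Fin n) ℝ) : Measure (Sample m n Ω) :=
  alg.seedLaw.prod (Measure.infinitePi fun _ : ℕ =>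
    Measure.pi fun p : Fin m × Fin n => gaussianReal (A p.1 p.2) 1)

/-- The outcomes observed in the first `t` rounds (if the algorithm has not halted). In each round
only the outcome of the pair that is played is observed. -/
def observed (alg : Algorithm m n Ω) (w : Sample m n Ω) : (t : ℕ) → Fin t → ℝ
  | 0 => Fin.elim0
  | t + 1 => Fin.snoc (α := fun _ => ℝ) (observed alg w t)
      (w.2 t (alg.play t (w.1, observed alg w t)))

/-- What the algorithm knows after `t` rounds: its seed and the outcomes observed so far. -/
def history (alg : Algorithm m n Ω) (w : Sample m n Ω) (t : ℕ) : Ω × (Fin t → ℝ) :=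
  (w.1, alg.observed w t)

/-- The number of rounds played before the algorithm halts, `⊤` if it never halts. -/
def stoppingTime (alg : Algorithm m n Ω) (w : Sample m n Ω) : ℕ∞ :=
  ⨅ (t : ℕ) (_ : alg.history w t ∈ alg.halt t), (t : ℕ∞)

/-- The expected number of rounds in the game `A`, possibly infinite. -/
def expectedTime (alg : Algorithm m n Ω) (A : Matrix (Fin m) (Fin n) ℝ) : ℝ≥0∞ :=
  ∫⁻ w, (alg.stoppingTime w : ℝ≥0∞) ∂(alg.law A)

/-- The event that the algorithm halts and its output is an `ε`-good solution of `A`. -/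
def goodEvent (alg : Algorithm m n Ω) (A : Matrix (Fin m) (Fin n) ℝ) (ε : ℝ) :
    Set (Sample m n Ω) :=
  {w | ∃ t : ℕ, alg.stoppingTime w = t ∧
    |value A - payoff A (alg.output t (alg.history w t)).1
      (alg.output t (alg.history w t)).2| ≤ ε}

/-- `(ε, δ)`-PAC-good: in every game the algorithm halts almost surely, and with probability at
least `1 - δ` its output is an `ε`-good solution. -/
def IsPACGood (alg : Algorithm m n Ω) (ε δ : ℝ) : Prop :=
  ∀ A : Matrix (Fin m) (Fin n) ℝ,
    (∀ᵐ w ∂(alg.law A), alg.stoppingTime w < ⊤) ∧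
      ENNReal.ofReal (1 - δ) ≤ alg.law A (alg.goodEvent A ε)

end Algorithm

end MatrixGame

end

/-!
The value `V` of a game is not affine in the matrix, whereas the payoff `⟨x, A y⟩` of fixed
strategies is linear. If `(x, y)` were `ε`-good for `A`, `A + M` and `A - M` at the same time, then
`|2 V(A) - V(A + M) - V(A - M)| ≤ 4 ε`. So a perturbation `M` whose second difference exceeds `4 ε`
leaves no output that is good for all three games. Two games would not suffice: the good sets of `A`
and of a single perturbation of it may intersect.

Since the output is good for `A` with probability at least `1 - δ`, in the game `A` it is bad for
one of `A ± M`, say for `B`, with probability at least `(1 - δ) / 2`, while in the game `B` this has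
probability at most `δ`. The transportation inequality `Algorithm.transport` turns this into
`log (1 / δ) * (1 - δ) / 2 ≤ log 2 + r² / 2 * E_A[τ]` if the entries of `M` are at most `r`
(`Algorithm.IsPACGood.log_le_expectedTime`). It rests on the fact that the law of the first `t`
observations in the game `B` has the density `exp llr` with respect to the one in `A`
(`Algorithm.histLaw_eq_withDensity`), on the tangent line bound `exp u ≥ 1 + u`, and on the fact
that each round lowers the mean of the log-likelihood ratio by at most `r² / 2`.

It remains to choose `M`. With `a`, `b`, `c`, `d` the entries of `A` and `D = a - b - c + d`, there
is always a suitable `M` of size `11 / 2 * max ε Δ` (`IsMixedOrdered.exists_perturbation`). If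
`Δ² > 3 ε D`, then `M = diag (r, -r)` with `r² = 5 / 2 * ε * D` works too: it keeps `D` and leaves
the equilibria mixed, so that the second difference can be read off from `V = (a d - b c) / D`
(`IsMixedOrdered.exists_perturbation_of_lt`). If `Δ² ≤ 3 ε D`, the second bound coincides with the
first one.
-/

namespace MatrixGame

/-! ### Gaussian likelihood ratios -/

/-- The logarithm of the density of `N(b, 1)` with respect to `N(a, 1)`, written so that its
`N(a, 1)`-centred part is visible. -/
noncomputable def gaussianLLR (a b x : ℝ) : ℝ := (b - a) * (x - a) - (b - a) ^ 2 / 2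

theorem lintegral_gaussianReal_eq (a b : ℝ) {φ : ℝ → ℝ≥0∞} (hφ : Measurable φ) :
    ∫⁻ x, φ x ∂gaussianReal b 1
      = ∫⁻ x, φ x * ENNReal.ofReal (Real.exp (gaussianLLR a b x)) ∂gaussianReal a 1 := by
  have hm : Measurable fun x => ENNReal.ofReal (Real.exp (gaussianLLR a b x)) := by
    unfold gaussianLLR
    fun_prop
  rw [gaussianReal_of_var_ne_zero _ one_ne_zero, gaussianReal_of_var_ne_zero _ one_ne_zero,
    lintegral_withDensity_eq_lintegral_mul _ (measurable_gaussianPDF _ _) hφ,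
    show (fun x => φ x * ENNReal.ofReal (Real.exp (gaussianLLR a b x)))
      = φ * fun x => ENNReal.ofReal (Real.exp (gaussianLLR a b x)) from rfl,
    lintegral_withDensity_eq_lintegral_mul _ (measurable_gaussianPDF _ _) (hφ.mul hm)]
  refine lintegral_congr fun x => ?_
  have h : gaussianPDF b 1 x
      = gaussianPDF a 1 x * ENNReal.ofReal (Real.exp (gaussianLLR a b x)) := by
    rw [gaussianPDF, gaussianPDF, ← ENNReal.ofReal_mul (gaussianPDFReal_nonneg _ _ _),
      gaussianPDFReal, gaussianPDFReal, mul_assoc _ (Real.exp _) (Real.exp _), ← Real.exp_add]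
    congr 3
    simp only [gaussianLLR, NNReal.coe_one]
    ring
  simp only [Pi.mul_apply, h]
  ring

namespace Algorithm

variable {m n : ℕ} {Ω : Type*} [MeasurableSpace Ω]

/-! ### The law of the history -/

/-- The law of the outcomes of all pairs in one round of the game `A`. -/
noncomputable def roundLaw (A : Matrix (Fin m) (Fin n) ℝ) : Measure (Fin m × Fin n → ℝ) :=
  Measure.pi fun p => gaussianReal (A p.1 p.2) 1

instance (A : Matrix (Fin m) (Fin n) ℝ) : IsProbabilityMeasure (roundLaw A) := by
  unfold roundLaw; infer_instance

instance (alg : Algorithm m n Ω) (A : Matrix (Fin m) (Fin n) ℝ) :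
    IsProbabilityMeasure (alg.law A) := by
  have := alg.isProbabilityMeasure_seedLaw
  unfold law; infer_instance

/-- Extend a history by the outcome of the pair that the algorithm plays next. -/
def step (alg : Algorithm m n Ω) (t : ℕ) (q : (Ω × (Fin t → ℝ)) × (Fin m × Fin n → ℝ)) :
    Ω × (Fin (t + 1) → ℝ) :=
  (q.1.1, Fin.snoc (α := fun _ => ℝ) q.1.2 (q.2 (alg.play t q.1)))

/-- Forget the last outcome of a history. -/
def past {t : ℕ} (h : Ω × (Fin (t + 1) → ℝ)) : Ω × (Fin t → ℝ) :=
  (h.1, Fin.init (α := fun _ => ℝ) h.2)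

@[simp] theorem past_step (alg : Algorithm m n Ω) (t : ℕ)
    (q : (Ω × (Fin t → ℝ)) × (Fin m × Fin n → ℝ)) : past (alg.step t q) = q.1 := by
  simp [past, step]

theorem measurable_past {t : ℕ} : Measurable (past : Ω × (Fin (t + 1) → ℝ) → _) := by
  unfold past Fin.init
  fun_prop

theorem history_succ (alg : Algorithm m n Ω) (w : Sample m n Ω) (t : ℕ) :
    alg.history w (t + 1) = alg.step t (alg.history w t, w.2 t) := rfl

@[simp] theorem past_history (alg : Algorithm m n Ω) (w : Sample m n Ω) (t : ℕ) :
    past (alg.history w (t + 1)) = alg.history w t := by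
  rw [history_succ, past_step]

theorem measurable_eval_pair :
    Measurable fun q : (Fin m × Fin n → ℝ) × (Fin m × Fin n) => q.1 q.2 :=
  measurable_from_prod_countable_left fun p => measurable_pi_apply p

theorem measurable_played (alg : Algorithm m n Ω) (t : ℕ) :
    Measurable fun q : (Ω × (Fin t → ℝ)) × (Fin m × Fin n → ℝ) => q.2 (alg.play t q.1) :=
  measurable_eval_pair.comp (measurable_snd.prodMk ((alg.measurable_play t).comp measurable_fst))

theorem measurable_step (alg : Algorithm m n Ω) (t : ℕ) : Measurable (alg.step t) := by
  refine (measurable_fst.comp measurable_fst).prodMk (measurable_pi_iff.2 fun i => ?_)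
  refine Fin.lastCases ?_ (fun j => ?_) i
  · simpa using alg.measurable_played t
  · simp only [Fin.snoc_castSucc]
    fun_prop

theorem measurable_history (alg : Algorithm m n Ω) (t : ℕ) :
    Measurable fun w : Sample m n Ω => alg.history w t := by
  induction t with
  | zero => exact measurable_fst.prodMk measurable_const
  | succ t ih =>
    simp only [history_succ]
    exact (alg.measurable_step t).comp
      (ih.prodMk ((measurable_pi_apply t).comp measurable_snd))

/-- The history after `t` rounds depends only on the seed and the outcomes of these rounds. -/
theorem history_congr (alg : Algorithm m n Ω) {w w' : Sample m n Ω} (h : w.1 = w'.1) {t : ℕ}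
    (h' : ∀ s < t, w.2 s = w'.2 s) : alg.history w t = alg.history w' t := by
  induction t with
  | zero => exact Prod.ext h rfl
  | succ t ih =>
    rw [history_succ, history_succ, ih fun s hs => h' s (by omega), h' t (by omega)]

/-- What is known after `t` rounds is independent of the outcomes of the next round. -/
theorem indepFun_history (alg : Algorithm m n Ω) (A : Matrix (Fin m) (Fin n) ℝ) (t : ℕ) :
    IndepFun (fun w => alg.history w t) (fun w => w.2 t) (alg.law A) := by
  have := alg.isProbabilityMeasure_seedLaw
  set P : Measure (ℕ → Fin m × Fin n → ℝ) := Measure.infinitePi fun _ => roundLaw A with hP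
  have hlaw : alg.law A = alg.seedLaw.prod P := rfl
  let U : (ℕ → Fin m × Fin n → ℝ) → (Finset.range t → Fin m × Fin n → ℝ) := fun x i => x i
  have hU : Measurable U := by fun_prop
  have hX : Measurable fun x : ℕ → Fin m × Fin n → ℝ => x t := by fun_prop
  have hUX : IndepFun U (fun x => x t) P := by
    have h := (iIndepFun_infinitePi (P := fun _ : ℕ => roundLaw A)
      (X := fun _ x => x) fun _ => measurable_id).indepFun_finset (Finset.range t) {t}
      (by simp) (fun i => measurable_pi_apply i)
    have heval : Measurable fun y : ({t} : Finset ℕ) → Fin m × Fin n → ℝ => y ⟨t, by simp⟩ :=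
      measurable_pi_apply _
    exact h.comp measurable_id heval
  -- Adjoining the seed to the first `t` rounds does not destroy the independence.
  have hseed : IndepFun (fun w : Sample m n Ω => (w.1, U w.2)) (fun w => w.2 t) (alg.law A) := by
    rw [hlaw, indepFun_iff_map_prod_eq_prod_map_map (by fun_prop) (by fun_prop)]
    have h1 : (alg.seedLaw.prod P).map (fun w => (w.1, U w.2)) = alg.seedLaw.prod (P.map U) := by
      have := Measure.map_prod_map alg.seedLaw P measurable_id hU
      rw [Measure.map_id] at this
      exact this.symm
    have h2 : (alg.seedLaw.prod P).map (fun w => w.2 t) = P.map (fun x => x t) := by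
      have : (fun w : Sample m n Ω => w.2 t) = (fun x => x t) ∘ Prod.snd := rfl
      rw [this, ← Measure.map_map hX measurable_snd]
      simp
    have h3 : (alg.seedLaw.prod P).map (fun w => (w.1, (U w.2, w.2 t)))
        = alg.seedLaw.prod ((P.map U).prod (P.map fun x => x t)) := by
      rw [← (indepFun_iff_map_prod_eq_prod_map_map hU.aemeasurable hX.aemeasurable).1 hUX]
      have := Measure.map_prod_map alg.seedLaw P measurable_id (hU.prodMk hX)
      rw [Measure.map_id] at this
      exact this.symm
    have : IsProbabilityMeasure (P.map U) := Measure.isProbabilityMeasure_map hU.aemeasurable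
    have : IsProbabilityMeasure (P.map fun x => x t) :=
      Measure.isProbabilityMeasure_map hX.aemeasurable
    rw [h1, h2, ← (measurePreserving_prodAssoc alg.seedLaw (P.map U)
      (P.map fun x => x t)).symm.map_eq, ← h3, Measure.map_map (by fun_prop) (by fun_prop)]
    rfl
  let ext : (Finset.range t → Fin m × Fin n → ℝ) → ℕ → Fin m × Fin n → ℝ :=
    fun u s => if hs : s ∈ Finset.range t then u ⟨s, hs⟩ else 0
  have hext : Measurable ext := by
    refine measurable_pi_iff.2 fun s => ?_
    by_cases hs : s ∈ Finset.range t
    · simp only [ext, hs, dite_true]; fun_prop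
    · simp only [ext, hs, dite_false]; fun_prop
  have hfac : (fun w => alg.history w t)
      = (fun z : Ω × (Finset.range t → Fin m × Fin n → ℝ) => alg.history (z.1, ext z.2) t) ∘
        fun w : Sample m n Ω => (w.1, U w.2) := by
    funext w
    refine alg.history_congr (w := w) (w' := (w.1, ext (U w.2))) rfl fun s hs => ?_
    simp [ext, U, hs]
  rw [hfac]
  exact hseed.comp (ψ := id) ((alg.measurable_history t).comp
    (measurable_fst.prodMk (hext.comp measurable_snd))) measurable_id

/-- The law of what is known after `t` rounds. -/
noncomputable def histLaw (alg : Algorithm m n Ω) (A : Matrix (Fin m) (Fin n) ℝ) (t : ℕ) :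
    Measure (Ω × (Fin t → ℝ)) :=
  (alg.law A).map fun w => alg.history w t

instance (alg : Algorithm m n Ω) (A : Matrix (Fin m) (Fin n) ℝ) (t : ℕ) :
    IsProbabilityMeasure (alg.histLaw A t) :=
  Measure.isProbabilityMeasure_map (alg.measurable_history t).aemeasurable

theorem map_round (alg : Algorithm m n Ω) (A : Matrix (Fin m) (Fin n) ℝ) (t : ℕ) :
    (alg.law A).map (fun w => w.2 t) = roundLaw A := by
  have := alg.isProbabilityMeasure_seedLaw
  have h : (fun w : Sample m n Ω => w.2 t) = (fun x => x t) ∘ Prod.snd := rfl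
  rw [h, ← Measure.map_map (by fun_prop) measurable_snd, law]
  simp only [Measure.map_snd_prod, measure_univ, one_smul]
  exact Measure.infinitePi_map_eval (fun _ : ℕ => roundLaw A) t

theorem histLaw_succ (alg : Algorithm m n Ω) (A : Matrix (Fin m) (Fin n) ℝ) (t : ℕ) :
    alg.histLaw A (t + 1) = ((alg.histLaw A t).prod (roundLaw A)).map (alg.step t) := by
  have hX : Measurable fun w : Sample m n Ω => w.2 t := by fun_prop
  have h := (indepFun_iff_map_prod_eq_prod_map_map
    (alg.measurable_history t).aemeasurable hX.aemeasurable).1 (alg.indepFun_history A t)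
  rw [map_round] at h
  rw [histLaw, histLaw, ← h, Measure.map_map (alg.measurable_step t)
    ((alg.measurable_history t).prodMk hX)]
  rfl

/-! ### Change of measure -/

/-- The log-likelihood ratio that one round contributes. -/
noncomputable def roundLLR (A B : Matrix (Fin m) (Fin n) ℝ) (p : Fin m × Fin n) (x : ℝ) : ℝ :=
  gaussianLLR (A p.1 p.2) (B p.1 p.2) x

/-- The log-likelihood ratio of the game `B` to the game `A`, after `t` rounds. -/
noncomputable def llr (alg : Algorithm m n Ω) (A B : Matrix (Fin m) (Fin n) ℝ) :
    (t : ℕ) → Ω × (Fin t → ℝ) → ℝ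
  | 0, _ => 0
  | t + 1, h => llr alg A B t (past h) +
      roundLLR A B (alg.play t (past h)) (h.2 (Fin.last t))

theorem measurable_roundLLR (A B : Matrix (Fin m) (Fin n) ℝ) :
    Measurable fun q : (Fin m × Fin n) × ℝ => roundLLR A B q.1 q.2 :=
  measurable_from_prod_countable_right fun p => by
    unfold roundLLR gaussianLLR
    fun_prop

theorem llr_succ (alg : Algorithm m n Ω) (A B : Matrix (Fin m) (Fin n) ℝ) (t : ℕ)
    (h : Ω × (Fin (t + 1) → ℝ)) :
    alg.llr A B (t + 1) h = alg.llr A B t (past h) +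
      roundLLR A B (alg.play t (past h)) (h.2 (Fin.last t)) := rfl

theorem llr_step (alg : Algorithm m n Ω) (A B : Matrix (Fin m) (Fin n) ℝ) (t : ℕ)
    (q : (Ω × (Fin t → ℝ)) × (Fin m × Fin n → ℝ)) :
    alg.llr A B (t + 1) (alg.step t q) = alg.llr A B t q.1 +
      roundLLR A B (alg.play t q.1) (q.2 (alg.play t q.1)) := by
  rw [llr_succ, past_step]
  simp [step]

theorem measurable_llr (alg : Algorithm m n Ω) (A B : Matrix (Fin m) (Fin n) ℝ) (t : ℕ) :
    Measurable (alg.llr A B t) := by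
  induction t with
  | zero => exact measurable_const
  | succ t ih =>
    have h : alg.llr A B (t + 1) = fun h => alg.llr A B t (past h) +
      roundLLR A B (alg.play t (past h)) (h.2 (Fin.last t)) := rfl
    rw [h]
    refine (ih.comp measurable_past).add ((measurable_roundLLR A B).comp
      (((alg.measurable_play t).comp measurable_past).prodMk ?_))
    fun_prop

theorem measurePreserving_eval_roundLaw (A : Matrix (Fin m) (Fin n) ℝ) (p : Fin m × Fin n) :
    MeasurePreserving (Function.eval p) (roundLaw A) (gaussianReal (A p.1 p.2) 1) :=
  measurePreserving_eval (fun p : Fin m × Fin n => gaussianReal (A p.1 p.2) 1) p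

theorem lintegral_roundLaw_eq (A B : Matrix (Fin m) (Fin n) ℝ) (p : Fin m × Fin n)
    {φ : ℝ → ℝ≥0∞} (hφ : Measurable φ) :
    ∫⁻ x, φ (x p) ∂roundLaw B
      = ∫⁻ x, φ (x p) * ENNReal.ofReal (Real.exp (roundLLR A B p (x p))) ∂roundLaw A := by
  have hm : Measurable fun x => φ x * ENNReal.ofReal (Real.exp (roundLLR A B p x)) := by
    unfold roundLLR gaussianLLR
    fun_prop
  have h : ∀ C : Matrix (Fin m) (Fin n) ℝ, ∀ ψ : ℝ → ℝ≥0∞, Measurable ψ →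
      ∫⁻ x, ψ (x p) ∂roundLaw C = ∫⁻ y, ψ y ∂gaussianReal (C p.1 p.2) 1 := by
    intro C ψ hψ
    rw [← (measurePreserving_eval_roundLaw C p).map_eq, lintegral_map hψ (by fun_prop)]
  rw [h B φ hφ, h A _ hm, lintegral_gaussianReal_eq _ _ hφ]
  rfl

theorem histLaw_eq_withDensity (alg : Algorithm m n Ω) (A B : Matrix (Fin m) (Fin n) ℝ) (t : ℕ) :
    alg.histLaw B t
      = (alg.histLaw A t).withDensity fun h => ENNReal.ofReal (Real.exp (alg.llr A B t h)) := by
  have hm : ∀ t, Measurable fun h => ENNReal.ofReal (Real.exp (alg.llr A B t h)) := fun t =>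
    (alg.measurable_llr A B t).exp.ennreal_ofReal
  induction t with
  | zero =>
    have hmap : ∀ C, alg.histLaw C 0 = alg.seedLaw.map fun ω => (ω, Fin.elim0) := by
      intro C
      have h : (fun w => alg.history w 0)
          = (fun ω => (ω, Fin.elim0)) ∘ (Prod.fst : Sample m n Ω → Ω) := rfl
      rw [histLaw, h, ← Measure.map_map (by fun_prop) measurable_fst,
        law, Measure.map_fst_prod]
      simp
    have h1 : (fun h => ENNReal.ofReal (Real.exp (alg.llr A B 0 h))) = 1 := by
      funext h
      simp [llr]
    rw [h1, withDensity_one, hmap, hmap]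
  | succ t ih =>
    refine Measure.ext_of_lintegral _ fun f hf => ?_
    have hs := alg.measurable_step t
    have hfs : Measurable fun q => f (alg.step t q) := hf.comp hs
    have hfr : Measurable fun q => f (alg.step t q) *
        ENNReal.ofReal (Real.exp (roundLLR A B (alg.play t q.1) (q.2 (alg.play t q.1)))) := by
      refine hfs.mul (Measurable.ennreal_ofReal (Measurable.exp ?_))
      exact (measurable_roundLLR A B).comp
        (((alg.measurable_play t).comp measurable_fst).prodMk (alg.measurable_played t))
    calc ∫⁻ h, f h ∂alg.histLaw B (t + 1)
        = ∫⁻ h, ∫⁻ x, f (alg.step t (h, x)) ∂roundLaw B ∂alg.histLaw B t := by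
          rw [histLaw_succ, lintegral_map hf hs, lintegral_prod _ hfs.aemeasurable]
      _ = ∫⁻ h, ∫⁻ x, f (alg.step t (h, x)) *
            ENNReal.ofReal (Real.exp (roundLLR A B (alg.play t h) (x (alg.play t h))))
              ∂roundLaw A ∂alg.histLaw B t := by
          refine lintegral_congr fun h => ?_
          refine lintegral_roundLaw_eq A B (alg.play t h)
            (φ := fun y => f (h.1, Fin.snoc (α := fun _ => ℝ) h.2 y)) (hf.comp ?_)
          refine measurable_const.prodMk (measurable_pi_iff.2 fun i => ?_)
          refine Fin.lastCases ?_ (fun j => ?_) i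
          · simpa using measurable_id'
          · simp
      _ = ∫⁻ h, ∫⁻ x, f (alg.step t (h, x)) *
            ENNReal.ofReal (Real.exp (alg.llr A B (t + 1) (alg.step t (h, x))))
              ∂roundLaw A ∂alg.histLaw A t := by
          rw [ih, lintegral_withDensity_eq_lintegral_mul _ (hm t) hfr.lintegral_prod_right']
          refine lintegral_congr fun h => ?_
          refine (lintegral_const_mul _ (hfr.comp (measurable_prodMk_left (x := h)))).symm.trans ?_
          refine lintegral_congr fun x => ?_
          simp only [Function.comp_apply]
          rw [llr_step, Real.exp_add, ENNReal.ofReal_mul (Real.exp_pos _).le]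
          ring
      _ = ∫⁻ h, f h ∂(alg.histLaw A (t + 1)).withDensity
            fun h => ENNReal.ofReal (Real.exp (alg.llr A B (t + 1) h)) := by
          have hg := (hm (t + 1)).mul hf
          rw [lintegral_withDensity_eq_lintegral_mul _ (hm (t + 1)) hf, histLaw_succ,
            lintegral_map hg hs]
          refine (Eq.trans ?_ (lintegral_prod _ (hg.comp hs).aemeasurable).symm)
          refine lintegral_congr fun h => lintegral_congr fun x => ?_
          simp [mul_comm]

/-! ### Moments of the log-likelihood ratio -/

theorem integrable_id_gaussianReal_one (a : ℝ) : Integrable (fun x => x) (gaussianReal a 1) :=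
  memLp_one_iff_integrable.1 (memLp_id_gaussianReal 1)

theorem integrable_gaussianLLR (a b : ℝ) : Integrable (gaussianLLR a b) (gaussianReal a 1) := by
  unfold gaussianLLR
  exact (((integrable_id_gaussianReal_one a).sub (integrable_const a)).const_mul (b - a)).sub
    (integrable_const _)

/-- The Kullback–Leibler divergence of two unit variance Gaussians, up to sign. -/
theorem integral_gaussianLLR (a b : ℝ) :
    ∫ x, gaussianLLR a b x ∂gaussianReal a 1 = -((b - a) ^ 2 / 2) := by
  have h := integrable_id_gaussianReal_one a
  unfold gaussianLLR
  have h' : Integrable (fun x => (b - a) * (x - a)) (gaussianReal a 1) :=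
    (h.sub (integrable_const a)).const_mul (b - a)
  rw [integral_sub h' (integrable_const _),
    integral_const_mul, integral_sub h (integrable_const a), integral_id_gaussianReal]
  simp

theorem integrable_roundLLR (A B : Matrix (Fin m) (Fin n) ℝ) (p : Fin m × Fin n) :
    Integrable (fun x => roundLLR A B p (x p)) (roundLaw A) :=
  (measurePreserving_eval_roundLaw A p).integrable_comp_of_integrable
    (integrable_gaussianLLR _ _)

theorem integral_roundLLR (A B : Matrix (Fin m) (Fin n) ℝ) (p : Fin m × Fin n) :
    ∫ x, roundLLR A B p (x p) ∂roundLaw A = -((B p.1 p.2 - A p.1 p.2) ^ 2 / 2) := by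
  rw [← integral_gaussianLLR, ← (measurePreserving_eval_roundLaw A p).map_eq, integral_map]
  · rfl
  · exact (measurable_pi_apply p).aemeasurable
  · rw [(measurePreserving_eval_roundLaw A p).map_eq]
    exact (integrable_gaussianLLR _ _).aestronglyMeasurable

theorem integrable_playedLLR (alg : Algorithm m n Ω) (A B : Matrix (Fin m) (Fin n) ℝ) (t : ℕ) :
    Integrable (fun q : (Ω × (Fin t → ℝ)) × (Fin m × Fin n → ℝ) =>
      roundLLR A B (alg.play t q.1) (q.2 (alg.play t q.1)))
      ((alg.histLaw A t).prod (roundLaw A)) := by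
  have hsum : Integrable (fun x : Fin m × Fin n → ℝ => ∑ p, |roundLLR A B p (x p)|)
      (roundLaw A) := integrable_finsetSum _ fun p _ => (integrable_roundLLR A B p).abs
  refine (hsum.comp_snd (alg.histLaw A t)).mono' ?_ (Filter.Eventually.of_forall fun q => ?_)
  · exact ((measurable_roundLLR A B).comp
      (((alg.measurable_play t).comp measurable_fst).prodMk
        (alg.measurable_played t))).aestronglyMeasurable
  · exact Finset.single_le_sum (f := fun p => |roundLLR A B p (q.2 p)|)
      (fun p _ => abs_nonneg _) (Finset.mem_univ _)

theorem integrable_llr_step (alg : Algorithm m n Ω) (A B : Matrix (Fin m) (Fin n) ℝ) {t : ℕ}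
    (h : Integrable (alg.llr A B t) (alg.histLaw A t)) :
    Integrable (fun q => alg.llr A B (t + 1) (alg.step t q))
      ((alg.histLaw A t).prod (roundLaw A)) := by
  simp only [llr_step]
  exact (h.comp_fst (roundLaw A)).add (alg.integrable_playedLLR A B t)

theorem integrable_llr (alg : Algorithm m n Ω) (A B : Matrix (Fin m) (Fin n) ℝ) (t : ℕ) :
    Integrable (alg.llr A B t) (alg.histLaw A t) := by
  induction t with
  | zero => exact integrable_zero _ _ _
  | succ t ih =>
    rw [histLaw_succ, integrable_map_measure (alg.measurable_llr A B _).aestronglyMeasurable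
      (alg.measurable_step t).aemeasurable]
    exact alg.integrable_llr_step A B ih

/-- One more round changes the integral of the log-likelihood ratio over an event by at most the
largest divergence of two entries. -/
theorem setIntegral_llr_succ_ge (alg : Algorithm m n Ω) {A B : Matrix (Fin m) (Fin n) ℝ} {r : ℝ}
    (hr : ∀ i j, |B i j - A i j| ≤ r) (t : ℕ) {S : Set (Ω × (Fin t → ℝ))}
    (hS : MeasurableSet S) :
    ∫ h in S, alg.llr A B t h ∂alg.histLaw A t - r ^ 2 / 2 * (alg.histLaw A t).real S
      ≤ ∫ h in past ⁻¹' S, alg.llr A B (t + 1) h ∂alg.histLaw A (t + 1) := by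
  have hpre : alg.step t ⁻¹' (past ⁻¹' S) = S ×ˢ Set.univ := by
    ext q
    simp
  have hint := alg.integrable_llr_step A B (alg.integrable_llr A B t)
  rw [histLaw_succ, setIntegral_map (measurable_past hS)
    (alg.measurable_llr A B _).aestronglyMeasurable (alg.measurable_step t).aemeasurable, hpre,
    setIntegral_prod _ hint.integrableOn, Measure.restrict_univ]
  have hinner : ∀ h, ∫ x, alg.llr A B (t + 1) (alg.step t (h, x)) ∂roundLaw A
      = alg.llr A B t h
        + -((B (alg.play t h).1 (alg.play t h).2 - A (alg.play t h).1 (alg.play t h).2) ^ 2 / 2) := by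
    intro h
    simp only [llr_step]
    rw [integral_add (integrable_const _) (integrable_roundLLR A B _), integral_roundLLR]
    simp
  have hint' := hint.integral_prod_left
  have hconst : ∫ h in S, alg.llr A B t h ∂alg.histLaw A t
      - r ^ 2 / 2 * (alg.histLaw A t).real S
      = ∫ h in S, (alg.llr A B t h - r ^ 2 / 2) ∂alg.histLaw A t := by
    rw [integral_sub (alg.integrable_llr A B t).integrableOn (integrable_const _)]
    simp [mul_comm]
  rw [hconst]
  refine setIntegral_mono (((alg.integrable_llr A B t).sub (integrable_const _)).integrableOn)
    hint'.integrableOn fun h => ?_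
  simp only [hinner]
  have hsq := sq_le_sq' (abs_le.1 (hr (alg.play t h).1 (alg.play t h).2)).1
    (abs_le.1 (hr (alg.play t h).1 (alg.play t h).2)).2
  linarith

/-- Transport of an event from `A` to `B`: the density `exp llr` is bounded below by a tangent line,
whose slope is a free parameter. -/
theorem setIntegral_llr_le (alg : Algorithm m n Ω) (A B : Matrix (Fin m) (Fin n) ℝ) (t : ℕ)
    {S : Set (Ω × (Fin t → ℝ))} (hS : MeasurableSet S) (κ : ℝ) :
    (1 + κ) * (alg.histLaw A t).real S + ∫ h in S, alg.llr A B t h ∂alg.histLaw A t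
      ≤ Real.exp κ * (alg.histLaw B t).real S := by
  have hfin : ∫⁻ h in S, ENNReal.ofReal (Real.exp (alg.llr A B t h)) ∂alg.histLaw A t
      = alg.histLaw B t S := by
    rw [alg.histLaw_eq_withDensity A B t, withDensity_apply _ hS]
  have hmeas := (alg.measurable_llr A B t).exp
  have hexp : IntegrableOn (fun h => Real.exp (alg.llr A B t h)) S (alg.histLaw A t) := by
    refine ⟨hmeas.aestronglyMeasurable, ?_⟩
    rw [hasFiniteIntegral_iff_ofReal (Filter.Eventually.of_forall fun _ => (Real.exp_pos _).le),
      hfin]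
    exact measure_lt_top _ _
  have hB : (alg.histLaw B t).real S
      = ∫ h in S, Real.exp (alg.llr A B t h) ∂alg.histLaw A t := by
    rw [integral_eq_lintegral_of_nonneg_ae
      (Filter.Eventually.of_forall fun _ => (Real.exp_pos _).le) hmeas.aestronglyMeasurable, hfin]
    rfl
  have hA : (1 + κ) * (alg.histLaw A t).real S + ∫ h in S, alg.llr A B t h ∂alg.histLaw A t
      = ∫ h in S, ((1 + κ) + alg.llr A B t h) ∂alg.histLaw A t := by
    rw [integral_add (integrable_const _) (alg.integrable_llr A B t).integrableOn]
    simp [mul_comm]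
  rw [hA, hB, ← integral_const_mul]
  refine setIntegral_mono
    (((integrable_const _).add (alg.integrable_llr A B t)).integrableOn)
    (hexp.const_mul _) fun h => ?_
  have := Real.add_one_le_exp (κ + alg.llr A B t h)
  simp only [← Real.exp_add]
  linarith

/-! ### Stopping -/

/-- The histories of length `t` along which the algorithm has not halted before round `t`. -/
def running (alg : Algorithm m n Ω) : (t : ℕ) → Set (Ω × (Fin t → ℝ))
  | 0 => Set.univ
  | t + 1 => past ⁻¹' (running alg t \ alg.halt t)

/-- The histories of length `t` after which the algorithm halts. -/
def stopped (alg : Algorithm m n Ω) (t : ℕ) : Set (Ω × (Fin t → ℝ)) :=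
  alg.running t ∩ alg.halt t

theorem measurableSet_running (alg : Algorithm m n Ω) (t : ℕ) :
    MeasurableSet (alg.running t) := by
  induction t with
  | zero => exact MeasurableSet.univ
  | succ t ih => exact measurable_past (ih.diff (alg.measurableSet_halt t))

theorem measurableSet_stopped (alg : Algorithm m n Ω) (t : ℕ) :
    MeasurableSet (alg.stopped t) :=
  (alg.measurableSet_running t).inter (alg.measurableSet_halt t)

theorem histLaw_succ_preimage_past (alg : Algorithm m n Ω) (A : Matrix (Fin m) (Fin n) ℝ) (t : ℕ)
    {S : Set (Ω × (Fin t → ℝ))} (hS : MeasurableSet S) :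
    alg.histLaw A (t + 1) (past ⁻¹' S) = alg.histLaw A t S := by
  rw [histLaw, histLaw, Measure.map_apply (alg.measurable_history _) (measurable_past hS),
    Measure.map_apply (alg.measurable_history _) hS]
  congr 1
  ext w
  simp

theorem real_running_succ (alg : Algorithm m n Ω) (A : Matrix (Fin m) (Fin n) ℝ) (t : ℕ) :
    (alg.histLaw A (t + 1)).real (alg.running (t + 1))
      = (alg.histLaw A t).real (alg.running t \ alg.halt t) :=
  congrArg ENNReal.toReal (alg.histLaw_succ_preimage_past A t
    ((alg.measurableSet_running t).diff (alg.measurableSet_halt t)))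

theorem sum_stopped_add_running (alg : Algorithm m n Ω) (A : Matrix (Fin m) (Fin n) ℝ) (T : ℕ) :
    ∑ t ∈ Finset.range T, (alg.histLaw A t).real (alg.stopped t)
      + (alg.histLaw A T).real (alg.running T) = 1 := by
  induction T with
  | zero => simp [running]
  | succ T ih =>
    rw [Finset.sum_range_succ, real_running_succ, add_assoc, stopped,
      measureReal_inter_add_sdiff (alg.measurableSet_halt T), ih]

/-- The transportation inequality for the algorithm stopped at a finite horizon. It is obtained by
transporting the events of halting inside `bad`, of halting outside `bad`, and of not halting, and
by telescoping the log-likelihood ratio. -/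
theorem transport_horizon (alg : Algorithm m n Ω) {A B : Matrix (Fin m) (Fin n) ℝ} {r : ℝ}
    (hr : ∀ i j, |B i j - A i j| ≤ r) {bad : (t : ℕ) → Set (Ω × (Fin t → ℝ))}
    (hbad : ∀ t, MeasurableSet (bad t)) (κ : ℝ) (T : ℕ)
    (hB : Real.exp κ * ∑ t ∈ Finset.range T, (alg.histLaw B t).real (alg.stopped t ∩ bad t) ≤ 1) :
    κ * ∑ t ∈ Finset.range T, (alg.histLaw A t).real (alg.stopped t ∩ bad t)
      ≤ Real.log 2
        + r ^ 2 / 2 * ∑ t ∈ Finset.range T, (alg.histLaw A (t + 1)).real (alg.running (t + 1)) := by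
  -- `setIntegral_llr_le` is used with `-log 2` outside `bad` and with `κ - log 2` inside `bad`, so
  -- that the probabilities in the game `B` have the weights `1 / 2` and `exp κ / 2`.
  have htele : ∀ T : ℕ,
      (1 - Real.log 2) * ∑ t ∈ Finset.range T, (alg.histLaw A t).real (alg.stopped t)
        + κ * ∑ t ∈ Finset.range T, (alg.histLaw A t).real (alg.stopped t ∩ bad t)
        - 1 / 2 * ∑ t ∈ Finset.range T, (alg.histLaw B t).real (alg.stopped t)
        - 1 / 2 * (Real.exp κ
          * ∑ t ∈ Finset.range T, (alg.histLaw B t).real (alg.stopped t ∩ bad t))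
        - r ^ 2 / 2 * ∑ t ∈ Finset.range T, (alg.histLaw A (t + 1)).real (alg.running (t + 1))
      ≤ ∫ h in alg.running T, alg.llr A B T h ∂alg.histLaw A T := by
    intro T
    induction T with
    | zero => simp [llr]
    | succ T ih =>
      simp only [Finset.sum_range_succ]
      have hrun := alg.measurableSet_running T
      have hhalt := alg.measurableSet_halt T
      have hst := alg.measurableSet_stopped T
      have h1 := alg.setIntegral_llr_succ_ge hr T (hrun.diff hhalt)
      rw [← real_running_succ] at h1
      have h2 := integral_inter_add_sdiff (s := alg.running T) hhalt
        (alg.integrable_llr A B T).integrableOn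
      have h3 := integral_inter_add_sdiff (s := alg.stopped T) (hbad T)
        (alg.integrable_llr A B T).integrableOn
      have h4 := alg.setIntegral_llr_le A B T (hst.inter (hbad T)) (κ - Real.log 2)
      have h5 := alg.setIntegral_llr_le A B T (hst.diff (hbad T)) (-Real.log 2)
      have h6 := measureReal_inter_add_sdiff (μ := alg.histLaw A T) (s := alg.stopped T) (hbad T)
      have h7 : (alg.histLaw B T).real (alg.stopped T \ bad T)
          ≤ (alg.histLaw B T).real (alg.stopped T) := measureReal_mono Set.sdiff_subset
      rw [Real.exp_sub, Real.exp_log two_pos] at h4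
      rw [Real.exp_neg, Real.exp_log two_pos] at h5
      change _ ≤ ∫ h in past ⁻¹' (alg.running T \ alg.halt T), _ ∂_
      change ∫ h in alg.stopped T, _ ∂_ + _ = _ at h2
      rw [← h6]
      linarith
  -- The histories that are still running at the horizon are transported like those outside `bad`.
  have h1 := htele T
  have h2 := alg.setIntegral_llr_le A B T (alg.measurableSet_running T) (-Real.log 2)
  rw [Real.exp_neg, Real.exp_log two_pos] at h2
  have h3 := alg.sum_stopped_add_running A T
  have h4 := alg.sum_stopped_add_running B T
  have h5 : (1 - Real.log 2) * (∑ t ∈ Finset.range T, (alg.histLaw A t).real (alg.stopped t))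
      + (1 - Real.log 2) * (alg.histLaw A T).real (alg.running T) = 1 - Real.log 2 := by
    rw [← mul_add, h3, mul_one]
  linarith

theorem history_mem_running (alg : Algorithm m n Ω) (w : Sample m n Ω) (t : ℕ) :
    alg.history w t ∈ alg.running t ↔ (t : ℕ∞) ≤ alg.stoppingTime w := by
  have h : (t : ℕ∞) ≤ alg.stoppingTime w ↔ ∀ s < t, alg.history w s ∉ alg.halt s := by
    simp only [stoppingTime, le_iInf_iff, Nat.cast_le]
    exact forall_congr' fun s => by rw [← not_lt]; tauto
  rw [h]
  clear h
  induction t with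
  | zero => simp [running]
  | succ t ih =>
    have : alg.history w (t + 1) ∈ alg.running (t + 1) ↔
        alg.history w t ∈ alg.running t ∧ alg.history w t ∉ alg.halt t := by
      simp [running]
    rw [this]
    simp only [ih, Nat.lt_succ_iff_lt_or_eq, or_imp, forall_and, forall_eq]

theorem history_mem_stopped (alg : Algorithm m n Ω) (w : Sample m n Ω) (t : ℕ) :
    alg.history w t ∈ alg.stopped t ↔ alg.stoppingTime w = t := by
  rw [stopped, Set.mem_inter_iff, history_mem_running]
  constructor
  · rintro ⟨h1, h2⟩
    exact le_antisymm (iInf₂_le t h2) h1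
  · intro h
    refine ⟨h.ge, by_contra fun hn => ?_⟩
    have h1 : alg.history w (t + 1) ∈ alg.running (t + 1) := by
      simpa [running, hn] using (alg.history_mem_running w t).2 h.ge
    rw [history_mem_running, h, Nat.cast_le] at h1
    omega

/-- The event that the algorithm halts with a history in `bad`. -/
def stopEvent (alg : Algorithm m n Ω) (bad : (t : ℕ) → Set (Ω × (Fin t → ℝ))) :
    Set (Sample m n Ω) :=
  {w | ∃ t : ℕ, alg.stoppingTime w = t ∧ alg.history w t ∈ bad t}

theorem stopEvent_eq_iUnion (alg : Algorithm m n Ω) (bad : (t : ℕ) → Set (Ω × (Fin t → ℝ))) :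
    alg.stopEvent bad = ⋃ t, (fun w => alg.history w t) ⁻¹' (alg.stopped t ∩ bad t) := by
  ext w
  simp [stopEvent, history_mem_stopped]

theorem measurableSet_stopEvent (alg : Algorithm m n Ω) {bad : (t : ℕ) → Set (Ω × (Fin t → ℝ))}
    (hbad : ∀ t, MeasurableSet (bad t)) : MeasurableSet (alg.stopEvent bad) := by
  rw [stopEvent_eq_iUnion]
  exact MeasurableSet.iUnion fun t =>
    alg.measurable_history t ((alg.measurableSet_stopped t).inter (hbad t))

theorem law_stopEvent (alg : Algorithm m n Ω) (A : Matrix (Fin m) (Fin n) ℝ)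
    {bad : (t : ℕ) → Set (Ω × (Fin t → ℝ))} (hbad : ∀ t, MeasurableSet (bad t)) :
    alg.law A (alg.stopEvent bad) = ∑' t, alg.histLaw A t (alg.stopped t ∩ bad t) := by
  have hm : ∀ t, MeasurableSet (alg.stopped t ∩ bad t) := fun t =>
    (alg.measurableSet_stopped t).inter (hbad t)
  rw [stopEvent_eq_iUnion, measure_iUnion]
  · exact tsum_congr fun t => (Measure.map_apply (alg.measurable_history t) (hm t)).symm
  · intro s t hst
    refine Set.disjoint_left.2 fun w hs ht => hst ?_
    have hs' := (alg.history_mem_stopped w s).1 hs.1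
    rw [(alg.history_mem_stopped w t).1 ht.1] at hs'
    exact_mod_cast hs'.symm
  · exact fun t => alg.measurable_history t (hm t)

theorem sum_indicator_le_stoppingTime (alg : Algorithm m n Ω) (w : Sample m n Ω) (T : ℕ) :
    ∑ t ∈ Finset.range T,
      ((fun w => alg.history w (t + 1)) ⁻¹' alg.running (t + 1)).indicator (1 : Sample m n Ω → ℝ≥0∞) w
      ≤ alg.stoppingTime w := by
  suffices h : ∑ t ∈ Finset.range T,
      ((fun w => alg.history w (t + 1)) ⁻¹' alg.running (t + 1)).indicator (1 : Sample m n Ω → ℝ≥0∞) w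
      ≤ min (T : ℝ≥0∞) (alg.stoppingTime w) from h.trans (min_le_right _ _)
  induction T with
  | zero => simp
  | succ T ih =>
    rw [Finset.sum_range_succ]
    by_cases hT : w ∈ (fun w => alg.history w (T + 1)) ⁻¹' alg.running (T + 1)
    · rw [Set.indicator_of_mem hT, Pi.one_apply]
      have h1 : ((T + 1 : ℕ) : ℝ≥0∞) ≤ alg.stoppingTime w := by
        have := (alg.history_mem_running w (T + 1)).1 hT
        exact_mod_cast ENat.toENNReal_le.2 this
      rw [min_eq_left h1, Nat.cast_succ]
      gcongr
      exact ih.trans (min_le_left _ _)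
    · rw [Set.indicator_of_notMem hT, add_zero]
      refine ih.trans (min_le_min_right _ ?_)
      exact_mod_cast Nat.le_succ T

theorem sum_running_le_expectedTime (alg : Algorithm m n Ω) (A : Matrix (Fin m) (Fin n) ℝ)
    (T : ℕ) :
    ∑ t ∈ Finset.range T, alg.histLaw A (t + 1) (alg.running (t + 1)) ≤ alg.expectedTime A := by
  have hm : ∀ t, MeasurableSet ((fun w => alg.history w (t + 1)) ⁻¹' alg.running (t + 1)) :=
    fun t => alg.measurable_history _ (alg.measurableSet_running _)
  calc ∑ t ∈ Finset.range T, alg.histLaw A (t + 1) (alg.running (t + 1))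
      = ∫⁻ w, ∑ t ∈ Finset.range T, ((fun w => alg.history w (t + 1)) ⁻¹'
          alg.running (t + 1)).indicator (1 : Sample m n Ω → ℝ≥0∞) w ∂alg.law A := by
        rw [lintegral_finsetSum _ fun t _ => measurable_one.indicator (hm t)]
        refine Finset.sum_congr rfl fun t _ => ?_
        rw [lintegral_indicator_one (hm t), histLaw,
          Measure.map_apply (alg.measurable_history _) (alg.measurableSet_running _)]
    _ ≤ alg.expectedTime A := lintegral_mono fun w => alg.sum_indicator_le_stoppingTime w T

/-- The transportation inequality: an event which is decided when the algorithm halts and which has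
probability at most `δ` in the game `B` can have a large probability in a nearby game `A` only if
the algorithm plays many rounds in `A`. -/
theorem transport (alg : Algorithm m n Ω) {A B : Matrix (Fin m) (Fin n) ℝ} {r δ : ℝ}
    (hr : ∀ i j, |B i j - A i j| ≤ r) (hδ : 0 < δ) {bad : (t : ℕ) → Set (Ω × (Fin t → ℝ))}
    (hbad : ∀ t, MeasurableSet (bad t))
    (hB : (alg.law B).real (alg.stopEvent bad) ≤ δ) (hτ : alg.expectedTime A ≠ ⊤) :
    Real.log (1 / δ) * (alg.law A).real (alg.stopEvent bad)
      ≤ Real.log 2 + r ^ 2 / 2 * (alg.expectedTime A).toReal := by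
  have hsum : ∀ C, HasSum (fun t => (alg.histLaw C t).real (alg.stopped t ∩ bad t))
      ((alg.law C).real (alg.stopEvent bad)) := by
    intro C
    have h := alg.law_stopEvent C hbad
    have hne : ∑' t, alg.histLaw C t (alg.stopped t ∩ bad t) ≠ ⊤ := h ▸ measure_ne_top _ _
    have := ENNReal.hasSum_toReal hne
    rwa [← ENNReal.tsum_toReal_eq fun t => measure_ne_top _ _, ← h] at this
  refine le_of_tendsto ((hsum A).tendsto_sum_nat.const_mul (Real.log (1 / δ)))
    (Filter.Eventually.of_forall fun T => ?_)
  refine (alg.transport_horizon hr hbad (Real.log (1 / δ)) T ?_).trans ?_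
  · rw [Real.exp_log (by positivity), one_div, inv_mul_le_iff₀ hδ, mul_one]
    exact (sum_le_hasSum _ (fun _ _ => measureReal_nonneg) (hsum B)).trans hB
  · gcongr
    have h := ENNReal.toReal_mono hτ (alg.sum_running_le_expectedTime A T)
    rwa [ENNReal.toReal_sum fun t _ => measure_ne_top _ _] at h

end Algorithm

/-! ### The value of a game -/

theorem payoff_add {m n : ℕ} (A B : Matrix (Fin m) (Fin n) ℝ) (x : Fin m → ℝ) (y : Fin n → ℝ) :
    payoff (A + B) x y = payoff A x y + payoff B x y := by
  simp [payoff, Matrix.add_mulVec]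

theorem payoff_sub {m n : ℕ} (A B : Matrix (Fin m) (Fin n) ℝ) (x : Fin m → ℝ) (y : Fin n → ℝ) :
    payoff (A - B) x y = payoff A x y - payoff B x y := by
  simp [payoff, Matrix.sub_mulVec]

theorem measurable_payoff {m n : ℕ} (A : Matrix (Fin m) (Fin n) ℝ) :
    Measurable fun z : (Fin m → ℝ) × (Fin n → ℝ) => payoff A z.1 z.2 := by
  unfold payoff Matrix.mulVec dotProduct
  fun_prop

theorem abs_payoff_le {m n : ℕ} (A : Matrix (Fin m) (Fin n) ℝ) {x : Fin m → ℝ} {y : Fin n → ℝ}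
    (hx : x ∈ stdSimplex ℝ (Fin m)) (hy : y ∈ stdSimplex ℝ (Fin n)) :
    |payoff A x y| ≤ ∑ i, ∑ j, |A i j| := by
  -- The coordinates of a point of the simplex are at most `1`.
  have hle : ∀ {k : ℕ} {z : Fin k → ℝ}, z ∈ stdSimplex ℝ (Fin k) → ∀ i, |z i| ≤ 1 := by
    intro k z hz i
    rw [abs_of_nonneg (hz.1 i), ← hz.2]
    exact Finset.single_le_sum (f := z) (fun i _ => hz.1 i) (Finset.mem_univ i)
  change |∑ i, x i * ∑ j, A i j * y j| ≤ _
  refine (Finset.abs_sum_le_sum_abs _ _).trans (Finset.sum_le_sum fun i _ => ?_)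
  rw [abs_mul]
  refine (mul_le_of_le_one_left (abs_nonneg _) (hle hx i)).trans
    ((Finset.abs_sum_le_sum_abs _ _).trans (Finset.sum_le_sum fun j _ => ?_))
  rw [abs_mul]
  exact mul_le_of_le_one_right (abs_nonneg _) (hle hy j)

/-- Any mixed strategy of the column player bounds the value from above. -/
theorem value_le {m n : ℕ} [NeZero m] (A : Matrix (Fin m) (Fin n) ℝ) {y : Fin n → ℝ}
    (hy : y ∈ stdSimplex ℝ (Fin n)) {v : ℝ} (h : ∀ i, (A *ᵥ y) i ≤ v) : value A ≤ v := by
  have : Nonempty (stdSimplex ℝ (Fin m)) := ⟨⟨_, single_mem_stdSimplex ℝ (0 : Fin m)⟩⟩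
  refine ciSup_le fun x => (ciInf_le ⟨-∑ i, ∑ j, |A i j|, ?_⟩ ⟨y, hy⟩).trans ?_
  · rintro _ ⟨y', rfl⟩
    exact (abs_le.1 (abs_payoff_le A x.2 y'.2)).1
  · calc payoff A x y = ∑ i, x.1 i * (A *ᵥ y) i := rfl
      _ ≤ ∑ i, x.1 i * v := Finset.sum_le_sum fun i _ => mul_le_mul_of_nonneg_left (h i) (x.2.1 i)
      _ = v := by rw [← Finset.sum_mul, x.2.2, one_mul]

/-- Any mixed strategy of the row player bounds the value from below. -/
theorem le_value {m n : ℕ} [NeZero n] (A : Matrix (Fin m) (Fin n) ℝ) {x : Fin m → ℝ}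
    (hx : x ∈ stdSimplex ℝ (Fin m)) {v : ℝ} (h : ∀ j, v ≤ (x ᵥ* A) j) : v ≤ value A := by
  have : Nonempty (stdSimplex ℝ (Fin n)) := ⟨⟨_, single_mem_stdSimplex ℝ (0 : Fin n)⟩⟩
  have hbdd : ∀ x : stdSimplex ℝ (Fin m),
      BddBelow (Set.range fun y : stdSimplex ℝ (Fin n) => payoff A x y) := by
    refine fun x => ⟨-∑ i, ∑ j, |A i j|, ?_⟩
    rintro _ ⟨y, rfl⟩
    exact (abs_le.1 (abs_payoff_le A x.2 y.2)).1
  refine le_trans (le_ciInf fun y => ?_)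
    (le_ciSup (f := fun x : stdSimplex ℝ (Fin m) => ⨅ y : stdSimplex ℝ (Fin n), payoff A x y)
      ⟨∑ i, ∑ j, |A i j|, ?_⟩ ⟨x, hx⟩)
  · calc v = ∑ j, v * y.1 j := by rw [← Finset.mul_sum, y.2.2, mul_one]
      _ ≤ ∑ j, (x ᵥ* A) j * y.1 j :=
          Finset.sum_le_sum fun j _ => mul_le_mul_of_nonneg_right (h j) (y.2.1 j)
      _ = payoff A x y := (Matrix.dotProduct_mulVec _ _ _).symm
  · rintro _ ⟨x', rfl⟩
    have y : stdSimplex ℝ (Fin n) := Classical.arbitrary _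
    exact (ciInf_le (hbdd x') y).trans (abs_le.1 (abs_payoff_le A x'.2 y.2)).2

/-- A saddle point of the matrix is a pure equilibrium, so it is excluded by a unique equilibrium
that is not pure. -/
theorem HasUniqueMixedNash.not_saddle {m n : ℕ} {A : Matrix (Fin m) (Fin n) ℝ}
    (hA : HasUniqueMixedNash A) (i : Fin m) (j : Fin n) :
    ¬ ((∀ i', A i' j ≤ A i j) ∧ ∀ j', A i j ≤ A i j') := by
  rintro ⟨hi, hj⟩
  obtain ⟨x, y, -, hpure, huniq⟩ := hA
  have hcol : ∀ x : Fin m → ℝ, payoff A x (Pi.single j 1) = ∑ i', x i' * A i' j := by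
    intro x
    simp [payoff, dotProduct]
  have hrow : ∀ y : Fin n → ℝ, payoff A (Pi.single i 1) y = ∑ j', A i j' * y j' := by
    intro y
    rw [payoff, single_one_dotProduct]
    rfl
  have hval : payoff A (Pi.single i 1) (Pi.single j 1) = A i j := by
    rw [hcol]; simp [Pi.single_apply]
  have hnash : IsNash A (Pi.single i 1) (Pi.single j 1) := by
    refine ⟨single_mem_stdSimplex ℝ i, single_mem_stdSimplex ℝ j, fun x' hx' => ?_,
      fun y' hy' => ?_⟩
    · rw [hval, hcol]
      calc ∑ i', x' i' * A i' j ≤ ∑ i', x' i' * A i j :=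
            Finset.sum_le_sum fun i' _ => mul_le_mul_of_nonneg_left (hi i') (hx'.1 i')
        _ = A i j := by rw [← Finset.sum_mul, hx'.2, one_mul]
    · rw [hval, hrow]
      calc A i j = ∑ j', A i j * y' j' := by rw [← Finset.mul_sum, hy'.2, mul_one]
        _ ≤ ∑ j', A i j' * y' j' :=
            Finset.sum_le_sum fun j' _ => mul_le_mul_of_nonneg_right (hj j') (hy'.1 j')
  obtain ⟨rfl, rfl⟩ := huniq _ _ hnash
  exact hpure ⟨i, j, by simp, by simp⟩

theorem pair_mem_stdSimplex {p : ℝ} (h0 : 0 ≤ p) (h1 : p ≤ 1) :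
    ![p, 1 - p] ∈ stdSimplex ℝ (Fin 2) := by
  refine ⟨fun i => ?_, by simp⟩
  fin_cases i
  · exact h0
  · simpa using h1

theorem value_two_le (A : Matrix (Fin 2) (Fin 2) ℝ) {q v : ℝ} (h0 : 0 ≤ q) (h1 : q ≤ 1)
    (hu : A 0 0 * q + A 0 1 * (1 - q) ≤ v) (hl : A 1 0 * q + A 1 1 * (1 - q) ≤ v) :
    value A ≤ v := by
  refine value_le A (pair_mem_stdSimplex h0 h1) fun i => ?_
  fin_cases i
  · simpa [Matrix.mulVec, dotProduct, Fin.sum_univ_two] using hu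
  · simpa [Matrix.mulVec, dotProduct, Fin.sum_univ_two] using hl

theorem le_value_two (A : Matrix (Fin 2) (Fin 2) ℝ) {p v : ℝ} (h0 : 0 ≤ p) (h1 : p ≤ 1)
    (hl : v ≤ p * A 0 0 + (1 - p) * A 1 0) (hr : v ≤ p * A 0 1 + (1 - p) * A 1 1) :
    v ≤ value A := by
  refine le_value A (pair_mem_stdSimplex h0 h1) fun j => ?_
  fin_cases j
  · simpa [Matrix.vecMul, dotProduct, Fin.sum_univ_two] using hl
  · simpa [Matrix.vecMul, dotProduct, Fin.sum_univ_two] using hr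

/-! ### Perturbations along which the value is far from affine -/

/-- The order relations between the entries of a `2 × 2` game whose equilibrium is fully mixed,
normalized so that the first row has the smallest gap and the first column the largest one. -/
structure IsMixedOrdered (A : Matrix (Fin 2) (Fin 2) ℝ) : Prop where
  row_zero : A 0 1 < A 0 0
  col_zero : A 1 0 < A 0 0
  col_one : A 0 1 < A 1 1
  row_one : A 1 0 < A 1 1
  le_row : A 0 0 - A 0 1 ≤ A 1 1 - A 1 0
  le_col_one : A 0 0 - A 0 1 ≤ A 1 1 - A 0 1
  col_le_col : A 1 1 - A 0 1 ≤ A 0 0 - A 1 0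

/-- The equalizing strategy of the column player bounds the value by `det / D`. -/
theorem value_le_det_div {A : Matrix (Fin 2) (Fin 2) ℝ} (hD : 0 < gapD A)
    (h1 : A 0 1 ≤ A 1 1) (h0 : A 1 0 ≤ A 0 0) :
    value A ≤ (A 0 0 * A 1 1 - A 0 1 * A 1 0) / gapD A := by
  have e : gapD A = A 0 0 - A 0 1 - A 1 0 + A 1 1 := rfl
  have hq : (A 1 1 - A 0 1) / gapD A * gapD A = A 1 1 - A 0 1 := div_mul_cancel₀ _ hD.ne'
  generalize hqdef : (A 1 1 - A 0 1) / gapD A = q at hq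
  refine value_two_le A (q := q) (hqdef ▸ div_nonneg (by linarith) hD.le)
    (hqdef ▸ (div_le_one hD).2 (by linarith)) ?_ ?_
  · rw [le_div_iff₀ hD]
    linear_combination (A 0 0 - A 0 1) * hq + A 0 1 * e
  · rw [le_div_iff₀ hD]
    linear_combination (A 1 0 - A 1 1) * hq + A 1 1 * e

/-- The strict inequalities hold because no entry is a saddle point and `D > 0`. -/
theorem isMixedOrdered {A : Matrix (Fin 2) (Fin 2) ℝ} (hA : HasUniqueMixedNash A)
    (hD : 0 < gapD A) (hmin : gapMin A = A 0 0 - A 0 1)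
    (hac : A 1 1 - A 0 1 ≤ A 0 0 - A 1 0) : IsMixedOrdered A := by
  have h00 := hA.not_saddle 0 0
  have h01 := hA.not_saddle 0 1
  have h10 := hA.not_saddle 1 0
  have h11 := hA.not_saddle 1 1
  simp only [Fin.forall_fin_two, le_refl, true_and, and_true, not_and, not_le] at h00 h01 h10 h11
  unfold gapD at hD
  have hnonneg : 0 ≤ gapMin A := by unfold gapMin; positivity
  have hrow : gapMin A ≤ |A 1 1 - A 1 0| := (min_le_right _ _).trans (min_le_right _ _)
  have hcol : gapMin A ≤ |A 1 1 - A 0 1| := (min_le_right _ _).trans (min_le_left _ _)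
  rw [hmin] at hnonneg hrow hcol
  have h1 : A 0 1 < A 0 0 := by
    by_contra hn
    have h2 : A 0 0 < A 1 0 := by
      by_contra h
      linarith [h00 (by linarith)]
    linarith [h10 h2.le]
  have h2 : A 0 1 < A 1 1 := by
    by_contra h
    linarith [h01 (by linarith)]
  have h3 : A 1 0 < A 0 0 := by linarith
  have h4 : A 1 0 < A 1 1 := h11 h2.le
  rw [abs_of_pos (by linarith)] at hrow hcol
  exact ⟨h1, h3, h2, h4, hrow, hcol, hac⟩

namespace IsMixedOrdered

variable {A : Matrix (Fin 2) (Fin 2) ℝ}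

theorem gapD_pos (h : IsMixedOrdered A) : 0 < gapD A := by
  unfold gapD
  linarith [h.row_zero, h.row_one]

/-- The lower bound for the value which the equalizing strategy of the row player guarantees. -/
theorem det_div_le_value (h : IsMixedOrdered A) :
    (A 0 0 * A 1 1 - A 0 1 * A 1 0) / gapD A ≤ value A := by
  have hD := h.gapD_pos
  have h1 := h.row_zero
  have h2 := h.row_one
  have hp : (A 1 1 - A 1 0) / gapD A * gapD A = A 1 1 - A 1 0 := div_mul_cancel₀ _ hD.ne'
  have e : gapD A = A 0 0 - A 0 1 - A 1 0 + A 1 1 := rfl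
  generalize hpdef : (A 1 1 - A 1 0) / gapD A = p at hp
  refine le_value_two A (p := p) (hpdef ▸ div_nonneg (by linarith) hD.le)
    (hpdef ▸ (div_le_one hD).2 (by linarith)) ?_ ?_
  · rw [div_le_iff₀ hD]
    linear_combination -(A 0 0 - A 1 0) * hp - A 1 0 * e
  · rw [div_le_iff₀ hD]
    linear_combination -(A 0 1 - A 1 1) * hp - A 1 1 * e

/-- A perturbation of size comparable with `max ε Δ`. If the second row can punish the row player
enough, making column `0` dominant in the first row costs a lot while the opposite change gains
nothing; otherwise the columns are shifted. -/
theorem exists_perturbation (h : IsMixedOrdered A) {ε η : ℝ} (hε : 0 < ε) (hεη : ε ≤ η)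
    (hη : A 0 0 - A 0 1 ≤ η) :
    ∃ M : Matrix (Fin 2) (Fin 2) ℝ, (∀ i j, |M i j| ≤ 11 / 2 * η) ∧
      value (A + M) + value (A - M) + 4 * ε < 2 * value A := by
  have hD := h.gapD_pos
  have e : gapD A = A 0 0 - A 0 1 - A 1 0 + A 1 1 := rfl
  have hV := h.det_div_le_value
  obtain ⟨h1, h2, h3, h4, h5, h6, h7⟩ := h
  have hq : (A 1 1 - A 0 1) / gapD A * gapD A = A 1 1 - A 0 1 := div_mul_cancel₀ _ hD.ne'
  have hq0 : 0 ≤ (A 1 1 - A 0 1) / gapD A := div_nonneg (by linarith) hD.le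
  have hq2 : (A 1 1 - A 0 1) / gapD A ≤ 1 / 2 := by rw [div_le_iff₀ hD]; linarith
  generalize (A 1 1 - A 0 1) / gapD A = q at hq hq0 hq2
  -- The strategy `(q, 1 - q)` of the column player makes both rows pay `V = det / D`.
  have hrow0 : (A 0 0 * A 1 1 - A 0 1 * A 1 0) / gapD A = A 0 0 * q + A 0 1 * (1 - q) := by
    rw [div_eq_iff hD.ne']
    linear_combination -(A 0 0 - A 0 1) * hq - A 0 1 * e
  have hrow1 : (A 0 0 * A 1 1 - A 0 1 * A 1 0) / gapD A = A 1 0 * q + A 1 1 * (1 - q) := by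
    rw [div_eq_iff hD.ne']
    linear_combination -(A 1 0 - A 1 1) * hq - A 1 1 * e
  generalize (A 0 0 * A 1 1 - A 0 1 * A 1 0) / gapD A = V at hV hrow0 hrow1
  have hVb : A 0 1 ≤ V := by nlinarith
  have hη0 : 0 < η := hε.trans_le hεη
  have habs : |11 / 2 * η| = 11 / 2 * η := abs_of_pos (by positivity)
  rcases lt_or_ge (4 * ε) ((1 - q) * (A 1 1 - A 1 0)) with hc | hc
  · refine ⟨!![-(11 / 2 * η), 11 / 2 * η; 0, 0], ?_, ?_⟩
    · simp only [Fin.forall_fin_two, Matrix.of_apply, Matrix.cons_val', Matrix.cons_val_zero,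
        Matrix.cons_val_one, abs_neg, abs_zero, habs]
      exact ⟨⟨le_rfl, le_rfl⟩, by positivity, by positivity⟩
    · -- Against `A + M` the column player uses column `0`, against `A - M` the strategy `q ≤ 1 / 2`.
      have hplus : value (A + !![-(11 / 2 * η), 11 / 2 * η; 0, 0])
          ≤ max (A 0 0 - 11 / 2 * η) (A 1 0) :=
        value_two_le _ zero_le_one le_rfl (by simp [sub_eq_add_neg]) (by simp)
      have hminus : value (A - !![-(11 / 2 * η), 11 / 2 * η; 0, 0]) ≤ V := by
        refine value_two_le _ hq0 (by linarith) ?_ ?_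
        · simp
          nlinarith
        · simp
          linarith
      have hmax : max (A 0 0 - 11 / 2 * η) (A 1 0) < V - 4 * ε :=
        max_lt (by linarith) (by linarith)
      linarith
  · refine ⟨!![-(11 / 2 * η), 11 / 2 * η; -(11 / 2 * η), 11 / 2 * η], ?_, ?_⟩
    · simp [Fin.forall_fin_two, habs]
    · -- The column player uses column `0` against `A + M` and column `1` against `A - M`.
      have hplus : value (A + !![-(11 / 2 * η), 11 / 2 * η; -(11 / 2 * η), 11 / 2 * η])
          ≤ A 0 0 - 11 / 2 * η :=
        value_two_le _ zero_le_one le_rfl (by simp [sub_eq_add_neg]) (by simp; linarith)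
      have hminus : value (A - !![-(11 / 2 * η), 11 / 2 * η; -(11 / 2 * η), 11 / 2 * η])
          ≤ A 1 1 - 11 / 2 * η :=
        value_two_le _ le_rfl zero_le_one (by simp; linarith) (by simp)
      have hd : A 1 1 - V ≤ 4 * ε := by nlinarith
      linarith

/-- If the gaps of the game are large compared with `√(ε D)`, the perturbed games still have mixed
equilibria, and the value is computed by the formula `det / D`, where `D` does not change. -/
theorem exists_perturbation_of_lt (h : IsMixedOrdered A) {ε : ℝ} (hε : 0 < ε)
    (hlt : 3 * ε * gapD A < (A 0 0 - A 0 1) ^ 2) :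
    ∃ M : Matrix (Fin 2) (Fin 2) ℝ, (∀ i j, |M i j| ≤ √(5 / 2 * ε * gapD A)) ∧
      value (A + M) + value (A - M) + 4 * ε < 2 * value A := by
  have hD := h.gapD_pos
  have hV := h.det_div_le_value
  obtain ⟨h1, h2, h3, h4, h5, h6, h7⟩ := h
  have hr0 : 0 < 5 / 2 * ε * gapD A := by positivity
  have hr2 := Real.sq_sqrt hr0.le
  have hrpos := Real.sqrt_pos.2 hr0
  have hrlt : √(5 / 2 * ε * gapD A) < A 0 0 - A 0 1 := by
    rw [Real.sqrt_lt' (by linarith)]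
    nlinarith [mul_pos hε hD]
  generalize √(5 / 2 * ε * gapD A) = r at hr2 hrpos hrlt
  -- `det (A + M) + det (A - M) = 2 * det A - 2 * r ^ 2` with `r ^ 2 = 5 / 2 * ε * D`.
  have hgap : gapD (A + !![r, 0; 0, -r]) = gapD A := by simp [gapD]; ring
  have hgap' : gapD (A - !![r, 0; 0, -r]) = gapD A := by simp [gapD]; ring
  refine ⟨!![r, 0; 0, -r], ?_, ?_⟩
  · simp [Fin.forall_fin_two, abs_of_pos hrpos, hrpos.le]
  · have hplus := value_le_det_div (A := A + !![r, 0; 0, -r]) (hgap ▸ hD)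
      (by simp; linarith) (by simp; linarith)
    have hminus := value_le_det_div (A := A - !![r, 0; 0, -r]) (hgap' ▸ hD)
      (by simp; linarith) (by simp; linarith)
    rw [hgap, le_div_iff₀ hD] at hplus
    rw [hgap', le_div_iff₀ hD] at hminus
    rw [div_le_iff₀ hD] at hV
    simp only [Matrix.add_apply, Matrix.sub_apply, Matrix.of_apply, Matrix.cons_val',
      Matrix.cons_val_zero, Matrix.cons_val_one, Matrix.cons_val_fin_one, add_zero, sub_zero]
      at hplus hminus
    refine lt_of_mul_lt_mul_right ?_ hD.le
    nlinarith [mul_pos hε hD]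

end IsMixedOrdered

namespace Algorithm

variable {m n : ℕ} {Ω : Type*} [MeasurableSpace Ω]

/-! ### Sample complexity -/

/-- The histories of length `t` whose output is not `ε`-good for the game `B`. -/
def badOutput (alg : Algorithm m n Ω) (B : Matrix (Fin m) (Fin n) ℝ) (ε : ℝ) (t : ℕ) :
    Set (Ω × (Fin t → ℝ)) :=
  {h | ε < |value B - payoff B (alg.output t h).1 (alg.output t h).2|}

theorem measurableSet_badOutput (alg : Algorithm m n Ω) (B : Matrix (Fin m) (Fin n) ℝ) (ε : ℝ)
    (t : ℕ) : MeasurableSet (alg.badOutput B ε t) :=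
  measurableSet_lt measurable_const
    (measurable_const.sub ((measurable_payoff B).comp (alg.measurable_output t))).abs

theorem IsPACGood.measureReal_bad_le {alg : Algorithm m n Ω} {ε δ : ℝ}
    (halg : alg.IsPACGood ε δ) (B : Matrix (Fin m) (Fin n) ℝ) :
    (alg.law B).real (alg.stopEvent (alg.badOutput B ε)) ≤ δ := by
  have hgood : 1 - δ ≤ (alg.law B).real (alg.goodEvent B ε) :=
    (ENNReal.ofReal_le_iff_le_toReal (measure_ne_top _ _)).1 (halg B).2
  have hdisj : Disjoint (alg.goodEvent B ε) (alg.stopEvent (alg.badOutput B ε)) := by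
    refine Set.disjoint_left.2 ?_
    rintro w ⟨s, hs, hgood⟩ ⟨t, ht, hbad⟩
    obtain rfl : s = t := by exact_mod_cast hs.symm.trans ht
    exact absurd hgood (not_le.2 hbad)
  have h := measureReal_union (μ := alg.law B) hdisj
    (alg.measurableSet_stopEvent (alg.measurableSet_badOutput B ε))
  have := measureReal_le_one (μ := alg.law B)
    (s := alg.goodEvent B ε ∪ alg.stopEvent (alg.badOutput B ε))
  linarith

/-- If the second difference of the value along `M` exceeds `4 ε`, no output is `ε`-good for all of
`A`, `A + M` and `A - M`, so that in the game `A` the output is often bad for one of `A ± M`. -/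
theorem IsPACGood.log_le_expectedTime {alg : Algorithm m n Ω} {ε δ : ℝ}
    (halg : alg.IsPACGood ε δ) (hδ0 : 0 < δ) (hδ : δ < 1 / 30) {A M : Matrix (Fin m) (Fin n) ℝ}
    {r : ℝ} (hr : ∀ i j, |M i j| ≤ r)
    (hM : value (A + M) + value (A - M) + 4 * ε < 2 * value A)
    (hτ : alg.expectedTime A ≠ ⊤) :
    29 / 30 * Real.log (1 / (30 * δ)) ≤ r ^ 2 * (alg.expectedTime A).toReal := by
  have hcover : alg.goodEvent A ε ⊆ alg.stopEvent (alg.badOutput (A + M) ε) ∪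
      alg.stopEvent (alg.badOutput (A - M) ε) := by
    rintro w ⟨t, ht, hgood⟩
    by_contra hn
    rw [Set.mem_union, not_or] at hn
    have hp : |_| ≤ ε := not_lt.1 fun h => hn.1 ⟨t, ht, h⟩
    have hm : |_| ≤ ε := not_lt.1 fun h => hn.2 ⟨t, ht, h⟩
    rw [payoff_add] at hp
    rw [payoff_sub] at hm
    linarith [(abs_le.1 hgood).2, (abs_le.1 hp).1, (abs_le.1 hm).1]
  have hgood : 1 - δ ≤ (alg.law A).real (alg.goodEvent A ε) :=
    (ENNReal.ofReal_le_iff_le_toReal (measure_ne_top _ _)).1 (halg A).2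
  have hsum := hgood.trans ((measureReal_mono hcover).trans (measureReal_union_le _ _))
  -- The two probabilities add up to at least `1 - δ > 29 / 30`.
  obtain ⟨B, hB, hBA⟩ : ∃ B, (∀ i j, |B i j - A i j| ≤ r) ∧
      29 / 60 ≤ (alg.law A).real (alg.stopEvent (alg.badOutput B ε)) := by
    rcases le_total (29 / 60) ((alg.law A).real (alg.stopEvent (alg.badOutput (A + M) ε)))
      with h | h
    · exact ⟨A + M, fun i j => by simpa using hr i j, h⟩
    · exact ⟨A - M, fun i j => by simpa using hr i j, by linarith⟩
  have htrans := alg.transport hB hδ0 (alg.measurableSet_badOutput B ε)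
    (halg.measureReal_bad_le B) hτ
  have hlog : Real.log (1 / δ) = Real.log (1 / (30 * δ)) + Real.log 30 := by
    rw [← Real.log_mul (by positivity) (by norm_num)]
    congr 1
    field_simp
  -- The part `29 / 60 * log 30` of the left-hand side pays for the `log 2` on the right.
  have hlog30 : 4 * Real.log 2 ≤ Real.log 30 := by
    have : Real.log ((2 : ℝ) ^ 4) ≤ Real.log 30 := Real.log_le_log (by norm_num) (by norm_num)
    rwa [Real.log_pow] at this
  have hL : 0 ≤ Real.log (1 / (30 * δ)) := by
    refine Real.log_nonneg ((one_le_div (by positivity)).2 (by linarith))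
  have hlog2 := Real.log_pos one_lt_two
  have := mul_le_mul_of_nonneg_left hBA (show 0 ≤ Real.log (1 / δ) by linarith)
  linarith

end Algorithm

end MatrixGame

theorem theorem2 {Ω : Type*} [MeasurableSpace Ω]
    (A : Matrix (Fin 2) (Fin 2) ℝ)
    (hA : MatrixGame.HasUniqueMixedNash A)
    (hD : 0 < MatrixGame.gapD A)
    (hmin : MatrixGame.gapMin A = A 0 0 - A 0 1)
    (hac : A 1 1 - A 0 1 ≤ A 0 0 - A 1 0)
    (ε δ : ℝ) (hε : 0 < ε) (hδ : δ ∈ Set.Ioo (0 : ℝ) 1)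
    (alg : MatrixGame.Algorithm 2 2 Ω) (halg : alg.IsPACGood ε δ) :
    ENNReal.ofReal
        (min (Real.log (1 / (30 * δ)) / (36 * ε ^ 2))
          (Real.log (1 / (30 * δ)) / (36 * MatrixGame.gapMin A ^ 2)))
      ≤ alg.expectedTime A ∧
    ENNReal.ofReal
        (min (1 / ε ^ 2)
            (max (1 / (3 * ε * |MatrixGame.gapD A|)) (1 / MatrixGame.gapMin A ^ 2))
          * (Real.log (1 / (30 * δ)) / 36))
      ≤ alg.expectedTime A := by
  have hmix := MatrixGame.isMixedOrdered hA hD hmin hac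
  have hΔ : 0 < A 0 0 - A 0 1 := sub_pos.2 hmix.row_zero
  rw [hmin, abs_of_pos hD]
  by_cases hτ : alg.expectedTime A = ⊤
  · simp [hτ]
  rw [ENNReal.ofReal_le_iff_le_toReal hτ, ENNReal.ofReal_le_iff_le_toReal hτ]
  have hE : 0 ≤ (alg.expectedTime A).toReal := ENNReal.toReal_nonneg
  generalize hL : Real.log (1 / (30 * δ)) = L
  -- Without `δ < 1 / 30` the logarithm is not positive and both bounds are trivial.
  rcases le_or_gt L 0 with hL0 | hL0
  · refine ⟨(min_le_left _ _).trans ((div_nonpos_of_nonpos_of_nonneg hL0 (by positivity)).trans hE),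
      (mul_nonpos_of_nonneg_of_nonpos ?_ (by linarith)).trans hE⟩
    exact le_min (by positivity) (le_max_of_le_right (by positivity))
  have hδ0 : 0 < 30 * δ := mul_pos (by norm_num) hδ.1
  have hδ30 : δ < 1 / 30 := by
    rw [← hL] at hL0
    have := (Real.log_pos_iff (by positivity)).1 hL0
    rw [lt_div_iff₀ hδ0] at this
    linarith
  -- `36 * (29 / 30)` exceeds the square of the factor `11 / 2` in the size of the perturbation.
  have hbound : ∀ η, ε ≤ η → A 0 0 - A 0 1 ≤ η →
      L / (36 * η ^ 2) ≤ (alg.expectedTime A).toReal := by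
    intro η hεη hη
    obtain ⟨M, hM, hval⟩ := hmix.exists_perturbation hε hεη hη
    have h := halg.log_le_expectedTime hδ.1 hδ30 hM hval hτ
    rw [hL] at h
    have hη0 : 0 < η := hε.trans_le hεη
    rw [div_le_iff₀ (by positivity)]
    have := mul_nonneg hE (sq_nonneg η)
    linarith
  -- `hbound` with `η = max ε Δ`.
  have hfirst : min (L / (36 * ε ^ 2)) (L / (36 * (A 0 0 - A 0 1) ^ 2))
      ≤ (alg.expectedTime A).toReal := by
    rcases le_total ε (A 0 0 - A 0 1) with h | h
    · exact (min_le_right _ _).trans (hbound _ h le_rfl)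
    · exact (min_le_left _ _).trans (hbound _ le_rfl h)
  refine ⟨hfirst, ?_⟩
  rcases le_or_gt ((A 0 0 - A 0 1) ^ 2) (3 * ε * MatrixGame.gapD A) with hcase | hcase
  · rw [max_eq_right (one_div_le_one_div_of_le (by positivity) hcase),
      min_mul_of_nonneg _ _ (by positivity), div_mul_div_comm, div_mul_div_comm, one_mul,
      mul_comm _ (36 : ℝ), mul_comm _ (36 : ℝ)]
    exact hfirst
  · obtain ⟨M, hM, hval⟩ := hmix.exists_perturbation_of_lt hε hcase
    have h := halg.log_le_expectedTime hδ.1 hδ30 hM hval hτ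
    rw [hL, Real.sq_sqrt (by positivity)] at h
    rw [max_eq_left (one_div_le_one_div_of_le (by positivity) hcase.le)]
    refine (mul_le_mul_of_nonneg_right (min_le_right _ _) (by positivity)).trans ?_
    rw [div_mul_div_comm, one_mul, div_le_iff₀ (by positivity)]
    have := mul_nonneg hE (mul_pos hε hD).le
    linarith
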